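/- Let $R$ be a commutative noetherian local ring with residue field $k$, let $n\ge 0$ be an integer and let $M$ be a finitely generated $R$-module. For finitely generated $R$-modules $A,B$ let $\underline{\mathrm{Hom}}_R(A,B)$ be the quotient of $\mathrm{Hom}_R(A,B)$ by the submodule of homomorphisms that factor through a projective module. Let $\Omega A$ be the syzygy of $A$, that is, the kernel of a surjection from a finitely generated free module onto $A$; lifting homomorphisms to these free modules and restricting to the kernels gives maps $\Omega:\underline{\mathrm{Hom}}_R(A,B)\to\underline{\mathrm{Hom}}_R(\Omega A,\Omega B)$, and $\Omega^n$ denotes the $n$-fold iterate. The $n$-th approximated $\xi$-invariant of $M$ is $$\xi_R(n,M)=\dim_k\operatorname{Ker}\bigl(\mathrm{Hom}_R(M,k)\to\underline{\mathrm{Hom}}_R(M,k)\xrightarrow{\Omega^n}\underline{\mathrm{Hom}}_R(\Omega^nM,\Omega^nk)\bigr).$$ An $n$-AB approximation of $M$ is a short exact sequence $0\to Y\xrightarrow{i}X\xrightarrow{p}M\to0$ of finitely generated $R$-modules such that $Y$ has projective dimension at most $n-1$ (meaning $Y=0$ if $n=0$) and $\mathrm{Ext}^j_R(X,R)=0$ for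 all $1\le j\le n$. It is minimal if for every direct sum decomposition $X=X_0\oplus X_1$ with $X_0\subseteq\operatorname{Im}i$ one has $X_0=0$. Suppose that $M$ has an $n$-AB approximation. Then $M$ has a minimal $n$-AB approximation, and for every minimal $n$-AB approximation $0\to Y_M\to X_M\to M\to0$ of $M$ the invariant $\xi_R(n,M)$ equals the rank of the largest free direct summand of $X_M$. -/

import Mathlib

open CategoryTheory

universe u

namespace ApproxXi

section Stable

variable (R : Type u) [CommRing R]

/-- The submodule `𝒫(M, N)` of `Hom_R(M, N)` consisting of the homomorphisms that factor through
some projective module. -/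
def projectiveMaps (M N : Type u) [AddCommGroup M] [Module R M] [AddCommGroup N] [Module R N] :
    Submodule R (M →ₗ[R] N) where
  carrier := {f | ∃ (P : Type u) (_ : AddCommGroup P) (_ : Module R P) (_ : Module.Projective R P)
    (g : M →ₗ[R] P) (h : P →ₗ[R] N), f = h ∘ₗ g}
  zero_mem' := ⟨PUnit, inferInstance, inferInstance, inferInstance, 0, 0, by simp⟩
  add_mem' := by
    rintro _ _ ⟨P, _, _, _, g, h, rfl⟩ ⟨Q, _, _, _, g', h', rfl⟩
    exact ⟨P × Q, inferInstance, inferInstance, inferInstance, g.prod g', h.coprod h', by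
      ext x; simp⟩
  smul_mem' := by
    rintro c _ ⟨P, _, _, _, g, h, rfl⟩
    exact ⟨P, inferInstance, inferInstance, inferInstance, g, c • h, by ext x; simp⟩

/-- Morphisms in the stable module category: `Hom_R(M, N) / 𝒫(M, N)`. -/
abbrev StableHom (M N : Type u) [AddCommGroup M] [Module R M] [AddCommGroup N] [Module R N] :
    Type u :=
  (M →ₗ[R] N) ⧸ projectiveMaps R M N

end Stable

section Syzygy

variable {R : Type u} [CommRing R]

/-- The number of generators in a chosen finite free cover of `M`. -/
noncomputable def coverRank (M : FGModuleCat.{u} R) : ℕ :=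
  (Module.Finite.exists_fin' R M).choose

/-- A chosen surjection from a finite free module onto `M`. -/
noncomputable def cover (M : FGModuleCat.{u} R) : (Fin (coverRank M) → R) →ₗ[R] M :=
  (Module.Finite.exists_fin' R M).choose_spec.choose

theorem cover_surjective (M : FGModuleCat.{u} R) : Function.Surjective (cover M) :=
  (Module.Finite.exists_fin' R M).choose_spec.choose_spec

variable {M N : FGModuleCat.{u} R}

theorem exists_coverLift (f : M →ₗ[R] N) :
    ∃ t : (Fin (coverRank M) → R) →ₗ[R] (Fin (coverRank N) → R),
      cover N ∘ₗ t = f ∘ₗ cover M :=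
  Module.projective_lifting_property (cover N) (f ∘ₗ cover M) (cover_surjective N)

/-- A chosen lift of a homomorphism to the free covers. -/
noncomputable def coverLift (f : M →ₗ[R] N) :
    (Fin (coverRank M) → R) →ₗ[R] (Fin (coverRank N) → R) :=
  (exists_coverLift f).choose

theorem cover_comp_coverLift (f : M →ₗ[R] N) : cover N ∘ₗ coverLift f = f ∘ₗ cover M :=
  (exists_coverLift f).choose_spec

/-- The map on kernels of the covers induced by a lift `t` of `f`. -/
noncomputable def kerMap (f : M →ₗ[R] N) (t : (Fin (coverRank M) → R) →ₗ[R] (Fin (coverRank N) → R))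
    (ht : cover N ∘ₗ t = f ∘ₗ cover M) :
    LinearMap.ker (cover M) →ₗ[R] LinearMap.ker (cover N) :=
  t.restrict fun x hx => by
    have h := LinearMap.congr_fun ht x
    simp only [LinearMap.comp_apply] at h
    rw [LinearMap.mem_ker] at hx ⊢
    rw [h, hx, map_zero]

/-- If `f` factors through a projective module, then so does the map on kernels
induced by any lift of `f`. -/
theorem kerMap_mem (f : M →ₗ[R] N) (t : (Fin (coverRank M) → R) →ₗ[R] (Fin (coverRank N) → R))
    (ht : cover N ∘ₗ t = f ∘ₗ cover M) (hf : f ∈ projectiveMaps R M N) :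
    kerMap f t ht ∈ projectiveMaps R (LinearMap.ker (cover M)) (LinearMap.ker (cover N)) := by
  obtain ⟨P, _, _, _, g, h, rfl⟩ := hf
  obtain ⟨h', hh'⟩ := Module.projective_lifting_property (cover N) h (cover_surjective N)
  have key : ∀ x, t x - h' (g (cover M x)) ∈ LinearMap.ker (cover N) := by
    intro x
    have h1 := LinearMap.congr_fun ht x
    have h2 := LinearMap.congr_fun hh' (g (cover M x))
    simp only [LinearMap.comp_apply] at h1 h2
    rw [LinearMap.mem_ker, map_sub, h1, h2, sub_self]
  refine ⟨Fin (coverRank M) → R, inferInstance, inferInstance, inferInstance,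
    (LinearMap.ker (cover M)).subtype,
    (t - h' ∘ₗ g ∘ₗ cover M).codRestrict (LinearMap.ker (cover N)) key, ?_⟩
  ext1 x
  apply Subtype.ext
  have hx : cover M (x : Fin (coverRank M) → R) = 0 := x.2
  simp [kerMap, hx]

theorem kerMap_sub_mem (f : M →ₗ[R] N)
    (t : (Fin (coverRank M) → R) →ₗ[R] (Fin (coverRank N) → R))
    (ht : cover N ∘ₗ t = f ∘ₗ cover M) :
    kerMap f (coverLift f) (cover_comp_coverLift f) - kerMap f t ht ∈
      projectiveMaps R (LinearMap.ker (cover M)) (LinearMap.ker (cover N)) := by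
  have h0 : cover N ∘ₗ (coverLift f - t) = (0 : M →ₗ[R] N) ∘ₗ cover M := by
    rw [LinearMap.comp_sub, cover_comp_coverLift, ht, sub_self, LinearMap.zero_comp]
  exact kerMap_mem 0 (coverLift f - t) h0 (Submodule.zero_mem _)

variable [IsNoetherianRing R]

/-- The syzygy `Ω M`: the kernel of the chosen finite free cover of `M`. It is well defined up to
projective summands. -/
noncomputable def syzygy (M : FGModuleCat.{u} R) : FGModuleCat.{u} R :=
  FGModuleCat.of R (LinearMap.ker (cover M))

/-- The homomorphism `Ω M → Ω N` induced by the chosen lift of `f` to the free covers. -/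
noncomputable def syzygyHom (f : M →ₗ[R] N) : syzygy M →ₗ[R] syzygy N :=
  kerMap f (coverLift f) (cover_comp_coverLift f)

/-- The map `Ω : Hom_R(M, N) → stable Hom_R(Ω M, Ω N)`. -/
noncomputable def syzygyHomₗ (M N : FGModuleCat.{u} R) :
    (M →ₗ[R] N) →ₗ[R] StableHom R (syzygy M) (syzygy N) where
  toFun f := Submodule.Quotient.mk (syzygyHom f)
  map_add' f g := by
    have ht : cover N ∘ₗ (coverLift f + coverLift g) = (f + g) ∘ₗ cover M := by
      rw [LinearMap.comp_add, cover_comp_coverLift, cover_comp_coverLift, LinearMap.add_comp]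
    exact (Submodule.Quotient.eq _).2 (kerMap_sub_mem (f + g) _ ht)
  map_smul' c f := by
    have ht : cover N ∘ₗ (c • coverLift f) = (c • f) ∘ₗ cover M := by
      rw [LinearMap.comp_smul, cover_comp_coverLift, LinearMap.smul_comp]
    exact (Submodule.Quotient.eq _).2 (kerMap_sub_mem (c • f) _ ht)

/-- The syzygy functor on morphisms of the stable category. -/
noncomputable def stableSyzygyMap (M N : FGModuleCat.{u} R) :
    StableHom R M N →ₗ[R] StableHom R (syzygy M) (syzygy N) :=
  (projectiveMaps R M N).liftQ (syzygyHomₗ M N) fun f hf =>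
    (Submodule.Quotient.mk_eq_zero _).2 (kerMap_mem f _ (cover_comp_coverLift f) hf)

/-- The iterated syzygy `Ωⁿ M`, where `Ω⁰ M = M` and `Ωⁿ⁺¹ M = Ω (Ωⁿ M)`. -/
noncomputable def syzygyPow : ℕ → FGModuleCat.{u} R → FGModuleCat.{u} R
  | 0, M => M
  | n + 1, M => syzygy (syzygyPow n M)

/-- The functor `Ωⁿ` on morphisms of the stable category. -/
noncomputable def stableSyzygyPowMap (M N : FGModuleCat.{u} R) :
    (n : ℕ) → StableHom R M N →ₗ[R] StableHom R (syzygyPow n M) (syzygyPow n N)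
  | 0 => LinearMap.id
  | n + 1 => stableSyzygyMap (syzygyPow n M) (syzygyPow n N) ∘ₗ stableSyzygyPowMap M N n

/-- `V_n(M, N)`: the kernel of the composite
`Hom_R(M, N) → stable Hom_R(M, N) → stable Hom_R(Ωⁿ M, Ωⁿ N)`. -/
noncomputable def V (n : ℕ) (M N : FGModuleCat.{u} R) : Submodule R (M →ₗ[R] N) :=
  LinearMap.ker (stableSyzygyPowMap M N n ∘ₗ (projectiveMaps R M N).mkQ)

end Syzygy

section Local

variable (R : Type u) [CommRing R] [IsLocalRing R] [IsNoetherianRing R]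

/-- `V_n(M) = V_n(M, k)`, where `k` is the residue field of `R`, as a `k`-subspace of
`Hom_R(M, k)`. -/
noncomputable def residueV (n : ℕ) (M : Type u) [AddCommGroup M] [Module R M] [Module.Finite R M] :
    Submodule (IsLocalRing.ResidueField R) (M →ₗ[R] IsLocalRing.ResidueField R) where
  carrier := {f | f ∈ (V n (FGModuleCat.of R M) (FGModuleCat.of R (IsLocalRing.ResidueField R)) :
    Submodule R (M →ₗ[R] IsLocalRing.ResidueField R))}
  zero_mem' := Submodule.zero_mem (V n (FGModuleCat.of R M)
    (FGModuleCat.of R (IsLocalRing.ResidueField R)))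
  add_mem' hf hg := Submodule.add_mem (V n (FGModuleCat.of R M)
    (FGModuleCat.of R (IsLocalRing.ResidueField R))) hf hg
  smul_mem' c f hf := by
    obtain ⟨r, rfl⟩ := IsLocalRing.residue_surjective c
    have h : IsLocalRing.residue R r • f = r • f := by
      ext x
      simp [Algebra.smul_def]
    rw [h]
    exact Submodule.smul_mem (V n (FGModuleCat.of R M)
      (FGModuleCat.of R (IsLocalRing.ResidueField R))) r hf

/-- The `n`-th approximated `ξ`-invariant `ξ_R(n, M) = dim_k V_n(M)`. -/
noncomputable def xi (n : ℕ) (M : Type u) [AddCommGroup M] [Module R M] [Module.Finite R M] : ℕ :=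
  Module.finrank (IsLocalRing.ResidueField R) (residueV R n M)

end Local

section Approximation

variable {R : Type u} [CommRing R]

/-- `0 → Y → X → M → 0` (with maps `i` and `p`) is an `n`-AB approximation of `M`: a short exact
sequence of finitely generated modules with `pd Y ≤ n - 1`, i.e. `pd Y < n`
(so that `Y = 0` if `n = 0`), and `Ext^j(X, R) = 0` for `1 ≤ j ≤ n`. -/
structure IsABApproximation (n : ℕ) {Y X M : Type u} [AddCommGroup Y] [Module R Y]
    [AddCommGroup X] [Module R X] [AddCommGroup M] [Module R M]
    (i : Y →ₗ[R] X) (p : X →ₗ[R] M) : Prop where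
  finite_left : Module.Finite R Y
  finite_middle : Module.Finite R X
  injective : Function.Injective i
  exact : Function.Exact i p
  surjective : Function.Surjective p
  projDim_lt : HasProjectiveDimensionLT (ModuleCat.of R Y) n
  ext_eq_zero : ∀ j : ℕ, 1 ≤ j → j ≤ n →
    Subsingleton (Abelian.Ext (ModuleCat.of R X) (ModuleCat.of R R) j)

/-- An `n`-AB approximation is minimal if `X = X₀ ⊕ X₁` with `X₀ ⊆ Im i` only for `X₀ = 0`. -/
structure IsMinimalABApproximation (n : ℕ) {Y X M : Type u} [AddCommGroup Y] [Module R Y]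
    [AddCommGroup X] [Module R X] [AddCommGroup M] [Module R M]
    (i : Y →ₗ[R] X) (p : X →ₗ[R] M) : Prop extends IsABApproximation n i p where
  minimal : ∀ X₀ X₁ : Submodule R X, IsCompl X₀ X₁ → X₀ ≤ LinearMap.range i → X₀ = ⊥

/-- The class `𝒜_n(R)` of finitely generated modules having an `n`-AB approximation. -/
def MemA (R : Type u) [CommRing R] (n : ℕ) (M : Type u) [AddCommGroup M] [Module R M] : Prop :=
  Module.Finite R M ∧
    ∃ (Y X : Type u) (_ : AddCommGroup Y) (_ : Module R Y) (_ : AddCommGroup X) (_ : Module R X)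
      (i : Y →ₗ[R] X) (p : X →ₗ[R] M), IsABApproximation n i p

/-- `X` has a direct summand that is free of rank `r`. -/
def HasFreeSummandOfRank (R : Type u) [CommRing R] (X : Type u) [AddCommGroup X] [Module R X]
    (r : ℕ) : Prop :=
  ∃ F N : Submodule R X, IsCompl F N ∧ Nonempty (F ≃ₗ[R] (Fin r → R))

end Approximation

end ApproxXi

/-! Let `p : X → M` be an `n`-AB approximation. The key fact (`mem_V_iff`) is that `f : M → N` lies
in `V n M N` exactly when `f ∘ₗ p` factors through a projective. It follows by dimension shifting:
`exists_syzygy_approximation` trades `p` for an approximation of `Ω M` with both homological bounds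
lowered by one, and `Ext¹(X, R) = 0` lets the factorization condition travel both ways. After `n`
steps the kernel is zero, so the approximating map is an isomorphism and the condition says that `Ωⁿ
f` is stably zero.

For `N = k` the condition says that `f ∘ₗ p` lifts to a linear form `X → R`. Independent functionals
in `V_n(M)` thus lift to a map `X → R^r` that is onto modulo the maximal ideal, hence onto by
Nakayama and split: `ξ` is at most the free rank of `X`. Conversely, if the approximation is
minimal, a linear form on `X` taking a unit value on `Im i` would split off a copy of `R` inside `Im
i`. So all forms reduce to functionals on `M`, and the coordinates of a free summand give
independent elements of `V_n(M)`. -/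

namespace ApproxXi

/-! ### Projective dimension and Ext vanishing under retracts and syzygies -/

section Homological

variable {R : Type u} [CommRing R]

theorem hasProjectiveDimensionLT_of_retract {A B : Type u} [AddCommGroup A] [Module R A]
    [AddCommGroup B] [Module R B] (s : A →ₗ[R] B) (r : B →ₗ[R] A) (h : r ∘ₗ s = LinearMap.id)
    {n : ℕ} (hB : HasProjectiveDimensionLT (ModuleCat.of R B) n) :
    HasProjectiveDimensionLT (ModuleCat.of R A) n := by
  let ρ : Retract (ModuleCat.of R A) (ModuleCat.of R B) :=
    { i := ModuleCat.ofHom s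
      r := ModuleCat.ofHom r
      retract := by rw [← ModuleCat.ofHom_comp, h]; rfl }
  exact ρ.hasProjectiveDimensionLT n

theorem hasProjectiveDimensionLT_congr {A B : Type u} [AddCommGroup A] [Module R A]
    [AddCommGroup B] [Module R B] (e : A ≃ₗ[R] B) {n : ℕ}
    (hB : HasProjectiveDimensionLT (ModuleCat.of R B) n) :
    HasProjectiveDimensionLT (ModuleCat.of R A) n :=
  hasProjectiveDimensionLT_of_retract e.toLinearMap e.symm.toLinearMap (by ext; simp) hB

theorem subsingleton_ext_of_retract {A B : Type u} [AddCommGroup A] [Module R A]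
    [AddCommGroup B] [Module R B] (s : A →ₗ[R] B) (r : B →ₗ[R] A) (h : r ∘ₗ s = LinearMap.id)
    (N : ModuleCat.{u} R) {j : ℕ} (hB : Subsingleton (Abelian.Ext (ModuleCat.of R B) N j)) :
    Subsingleton (Abelian.Ext (ModuleCat.of R A) N j) := by
  refine subsingleton_of_forall_eq 0 fun x => ?_
  have h1 : ModuleCat.ofHom s ≫ ModuleCat.ofHom r = 𝟙 (ModuleCat.of R A) := by
    rw [← ModuleCat.ofHom_comp, h]; rfl
  rw [← x.mk₀_id_comp, ← h1, ← Abelian.Ext.mk₀_comp_mk₀_assoc,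
    Subsingleton.elim ((Abelian.Ext.mk₀ (ModuleCat.ofHom r)).comp x (zero_add j)) 0,
    Abelian.Ext.comp_zero]

/-- A module of projective dimension at most `n` is covered by a projective module with kernel of
projective dimension less than `n`. -/
theorem exists_projective_cover_ker_hasProjectiveDimensionLT (K : Type u) [AddCommGroup K]
    [Module R K] (n : ℕ) (hK : HasProjectiveDimensionLT (ModuleCat.of R K) (n + 1)) :
    ∃ (G : Type u) (_ : AddCommGroup G) (_ : Module R G) (_ : Module.Projective R G)
      (e : G →ₗ[R] K), Function.Surjective e ∧
      HasProjectiveDimensionLT (ModuleCat.of R (LinearMap.ker e)) n := by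
  cases n with
  | zero =>
    have hP : Projective (ModuleCat.of R K) :=
      projective_iff_hasProjectiveDimensionLT_one.2 hK
    -- Projective dimension less than 0 means zero, so the cover must be an isomorphism; `K` is
    -- projective and covers itself.
    refine ⟨K, inferInstance, inferInstance, (IsProjective.iff_projective K).2 hP,
      LinearMap.id, Function.surjective_id, ?_⟩
    apply Limits.IsZero.hasProjectiveDimensionLT_zero
    rw [LinearMap.ker_id]
    exact ModuleCat.isZero_of_subsingleton _
  | succ n =>
    let e : (K →₀ R) →ₗ[R] K := Finsupp.linearCombination R id
    have he : Function.Surjective e := Finsupp.linearCombination_id_surjective R K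
    refine ⟨K →₀ R, inferInstance, inferInstance, inferInstance, e, he, ?_⟩
    have hS := LinearMap.shortExact_shortComplexKer he
    have hp : Projective (ModuleCat.of R (K →₀ R)) :=
      (IsProjective.iff_projective _).1 inferInstance
    exact (hS.hasProjectiveDimensionLT_X₃_iff n hp).1 hK

/-- In the long exact sequence, `Ext^j(ker c, N)` sits between `Ext^j(P, N) = 0` and `Ext^(j+1)(X,
N)`. -/
theorem subsingleton_ext_ker {P X : Type u} [AddCommGroup P] [Module R P] [Module.Projective R P]
    [AddCommGroup X] [Module R X] {c : P →ₗ[R] X} (hc : Function.Surjective c)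
    (N : ModuleCat.{u} R) {j : ℕ} (hj : 1 ≤ j)
    (hX : Subsingleton (Abelian.Ext (ModuleCat.of R X) N (j + 1))) :
    Subsingleton (Abelian.Ext (ModuleCat.of R (LinearMap.ker c)) N j) := by
  have hS := LinearMap.shortExact_shortComplexKer hc
  have hp : Projective (ModuleCat.of R P) := (IsProjective.iff_projective _).1 inferInstance
  refine subsingleton_of_forall_eq 0 fun x => ?_
  obtain ⟨x₂, rfl⟩ := Abelian.Ext.contravariant_sequence_exact₁ hS N x (add_comm 1 j)
    (hX.elim _ _)
  obtain ⟨j, rfl⟩ := Nat.exists_eq_add_of_le' hj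
  have : x₂ = 0 := Abelian.Ext.eq_zero_of_projective (P := ModuleCat.of R P) x₂
  rw [this, Abelian.Ext.comp_zero]

/-- The obstruction to extending `g` to `P` is its image under the connecting map into `Ext¹(X, N)`.
-/
theorem exists_extend_of_subsingleton_ext_one {P X : Type u} [AddCommGroup P] [Module R P]
    [AddCommGroup X] [Module R X] {c : P →ₗ[R] X} (hc : Function.Surjective c)
    (N : Type u) [AddCommGroup N] [Module R N]
    (hX : Subsingleton (Abelian.Ext (ModuleCat.of R X) (ModuleCat.of R N) 1))
    (g : LinearMap.ker c →ₗ[R] N) :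
    ∃ g' : P →ₗ[R] N, g' ∘ₗ (LinearMap.ker c).subtype = g := by
  have hS := LinearMap.shortExact_shortComplexKer hc
  obtain ⟨x₂, hx₂⟩ := Abelian.Ext.contravariant_sequence_exact₁ hS (ModuleCat.of R N)
    (Abelian.Ext.mk₀ (ModuleCat.ofHom g)) (add_zero 1) (hX.elim _ _)
  obtain ⟨φ, rfl⟩ := Abelian.Ext.mk₀_bijective _ _ |>.2 x₂
  rw [Abelian.Ext.mk₀_comp_mk₀] at hx₂
  have := (Abelian.Ext.mk₀_bijective _ _).1 hx₂
  exact ⟨φ.hom, congrArg ModuleCat.Hom.hom this⟩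

end Homological

/-! ### Factoring through projectives, before and after passing to kernels -/

section Step

variable {R : Type u} [CommRing R]

theorem comp_mem_projectiveMaps {A B C : Type u} [AddCommGroup A] [Module R A] [AddCommGroup B]
    [Module R B] [AddCommGroup C] [Module R C] (g : A →ₗ[R] B) {f : B →ₗ[R] C}
    (hf : f ∈ projectiveMaps R B C) : f ∘ₗ g ∈ projectiveMaps R A C := by
  obtain ⟨P, _, _, _, a, b, rfl⟩ := hf
  exact ⟨P, inferInstance, inferInstance, inferInstance, a ∘ₗ g, b, rfl⟩

/-- A map that factors through a projective module lifts along every surjection. -/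
theorem exists_lift_of_mem_projectiveMaps {A B Q : Type u} [AddCommGroup A] [Module R A]
    [AddCommGroup B] [Module R B] [AddCommGroup Q] [Module R Q] {f : A →ₗ[R] B}
    (hf : f ∈ projectiveMaps R A B) {d : Q →ₗ[R] B} (hd : Function.Surjective d) :
    ∃ g : A →ₗ[R] Q, d ∘ₗ g = f := by
  obtain ⟨P, _, _, _, a, b, rfl⟩ := hf
  obtain ⟨b', rfl⟩ := Module.projective_lifting_property d b hd
  exact ⟨b' ∘ₗ a, rfl⟩

variable {X P B Q : Type u} [AddCommGroup X] [Module R X] [AddCommGroup P] [Module R P]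
  [AddCommGroup B] [Module R B] [AddCommGroup Q] [Module R Q]

/-- If `f` factors through a projective module, then so does the map induced on the kernels of
projective covers. -/
theorem restrict_mem_projectiveMaps [Module.Projective R P]
    {c : P →ₗ[R] X} {d : Q →ₗ[R] B} (hd : Function.Surjective d) {f : X →ₗ[R] B}
    {t : P →ₗ[R] Q} (ht : d ∘ₗ t = f ∘ₗ c) {t' : LinearMap.ker c →ₗ[R] LinearMap.ker d}
    (ht' : ∀ x, (t' x : Q) = t x) (hf : f ∈ projectiveMaps R X B) :
    t' ∈ projectiveMaps R (LinearMap.ker c) (LinearMap.ker d) := by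
  obtain ⟨g, rfl⟩ := exists_lift_of_mem_projectiveMaps hf hd
  -- Subtracting `g ∘ₗ c` leaves `t` unchanged on `ker c` and makes it land in `ker d` on all of
  -- `P`, so `t'` factors through `P`.
  have key : ∀ x, (t - g ∘ₗ c) x ∈ LinearMap.ker d := fun x => by
    have := LinearMap.congr_fun ht x
    simp only [LinearMap.comp_apply] at this
    simp [this]
  refine ⟨P, inferInstance, inferInstance, inferInstance, (LinearMap.ker c).subtype,
    (t - g ∘ₗ c).codRestrict _ key, ?_⟩
  ext x
  have hx : c x = 0 := x.2
  simp [hx, ht']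

/-- If `Ext¹(X, R) = 0` and the map induced by `f` on kernels of projective covers factors
through a projective module, then so does `f`. -/
theorem mem_projectiveMaps_of_restrict [Module.Projective R Q]
    {c : P →ₗ[R] X} (hc : Function.Surjective c) {d : Q →ₗ[R] B}
    [Module.Finite R (LinearMap.ker d)] {f : X →ₗ[R] B}
    (hX : Subsingleton (Abelian.Ext (ModuleCat.of R X) (ModuleCat.of R R) 1))
    {t : P →ₗ[R] Q} (ht : d ∘ₗ t = f ∘ₗ c) {t' : LinearMap.ker c →ₗ[R] LinearMap.ker d}
    (ht' : ∀ x, (t' x : Q) = t x)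
    (hf : t' ∈ projectiveMaps R (LinearMap.ker c) (LinearMap.ker d)) :
    f ∈ projectiveMaps R X B := by
  obtain ⟨m, e, he⟩ := Module.Finite.exists_fin' R (LinearMap.ker d)
  obtain ⟨g, hg⟩ := exists_lift_of_mem_projectiveMaps hf he
  choose g' hg' using fun i : Fin m =>
    exists_extend_of_subsingleton_ext_one hc R hX (LinearMap.proj i ∘ₗ g)
  -- The map `g` into `R^m` extends to `P` coordinatewise. The corrected lift `s` kills `ker c`, so
  -- it descends to `X → Q`; the correction has values in `ker d`, so `s` still lies over `f`.
  let s : P →ₗ[R] Q := t - (LinearMap.ker d).subtype ∘ₗ e ∘ₗ LinearMap.pi g'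
  have hs : LinearMap.ker c ≤ LinearMap.ker s := fun x hx => by
    have h1 : LinearMap.pi g' x = g ⟨x, hx⟩ := by
      ext i
      exact LinearMap.congr_fun (hg' i) ⟨x, hx⟩
    have h2 : e (g ⟨x, hx⟩) = t' ⟨x, hx⟩ := LinearMap.congr_fun hg _
    simp [s, h1, h2, ht']
  let E := c.quotKerEquivOfSurjective hc
  refine ⟨Q, inferInstance, inferInstance, inferInstance,
    (LinearMap.ker c).liftQ s hs ∘ₗ E.symm.toLinearMap, d, ?_⟩
  ext x
  obtain ⟨x, rfl⟩ := hc x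
  have h1 : E.symm (c x) = (LinearMap.ker c).mkQ x := by
    rw [LinearEquiv.symm_apply_eq]; rfl
  have h2 := LinearMap.congr_fun ht x
  simp only [LinearMap.comp_apply] at h2
  simp only [LinearMap.comp_apply, LinearEquiv.coe_coe, h1, Submodule.mkQ_apply,
    Submodule.liftQ_apply]
  simp [s, h2]

end Step

/-! ### Dimension shifting along an approximation -/

section Shift

variable {R : Type u} [CommRing R] [IsNoetherianRing R]

/-- One step of the dimension shift: an approximation `p : X → M` is replaced by an approximation
of the syzygy of `M`. -/
theorem exists_syzygy_approximation {M N : FGModuleCat.{u} R} (f : M →ₗ[R] N) {m : ℕ}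
    {X : Type u} [AddCommGroup X] [Module R X] (p : X →ₗ[R] M) (hp : Function.Surjective p)
    (hK : HasProjectiveDimensionLT (ModuleCat.of R (LinearMap.ker p)) (m + 1))
    (hX : ∀ j, 1 ≤ j → j ≤ m + 1 →
      Subsingleton (Abelian.Ext (ModuleCat.of R X) (ModuleCat.of R R) j)) :
    ∃ (X' : Type u) (_ : AddCommGroup X') (_ : Module R X') (p' : X' →ₗ[R] syzygy M),
      Function.Surjective p' ∧
      HasProjectiveDimensionLT (ModuleCat.of R (LinearMap.ker p')) m ∧
      (∀ j, 1 ≤ j → j ≤ m →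
        Subsingleton (Abelian.Ext (ModuleCat.of R X') (ModuleCat.of R R) j)) ∧
      (syzygyHom f ∘ₗ p' ∈ projectiveMaps R X' (syzygy N) ↔
        f ∘ₗ p ∈ projectiveMaps R X N) := by
  obtain ⟨G, _, _, _, e, he, hke⟩ :=
    exists_projective_cover_ker_hasProjectiveDimensionLT _ m hK
  obtain ⟨s, hs⟩ := Module.projective_lifting_property p (cover M) hp
  have hs' : ∀ v, p (s v) = cover M v := LinearMap.congr_fun hs
  -- Horseshoe construction: covers of `ker p` and `M` combine to a cover of `X`, giving `0 → ker e
  -- → ker c → Ω M → 0`.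
  let c : (G × (Fin (coverRank M) → R)) →ₗ[R] X :=
    ((LinearMap.ker p).subtype ∘ₗ e).coprod s
  have hpc : ∀ x, p (c x) = cover M x.2 := fun x => by
    have : p (e x.1 : X) = 0 := (e x.1).2
    simp [c, hs', this]
  have hc : Function.Surjective c := fun x => by
    obtain ⟨v, hv⟩ := cover_surjective M (p x)
    obtain ⟨g, hg⟩ := he ⟨x - s v, by simp [hs', hv]⟩
    exact ⟨(g, v), by simp [c, hg]⟩
  let p' : LinearMap.ker c →ₗ[R] LinearMap.ker (cover M) :=
    (LinearMap.snd R G _).restrict fun x hx => by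
      rw [LinearMap.mem_ker] at hx ⊢
      rw [LinearMap.snd_apply, ← hpc, hx, map_zero]
  refine ⟨LinearMap.ker c, inferInstance, inferInstance, p', ?_, ?_, ?_, ?_⟩
  · intro v
    have hv : cover M v.1 = 0 := v.2
    obtain ⟨g, hg⟩ := he ⟨-s v.1, by simp [hs', hv]⟩
    exact ⟨⟨(g, v.1), by simp [c, hg]⟩, rfl⟩
  · let a : LinearMap.ker p' →ₗ[R] LinearMap.ker e :=
      (LinearMap.fst R G _ ∘ₗ (LinearMap.ker c).subtype ∘ₗ (LinearMap.ker p').subtype).codRestrict _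
        fun x => by
          have h1 : c x.1.1 = 0 := x.1.2
          have h2 : x.1.1.2 = 0 := congrArg Subtype.val x.2
          rw [LinearMap.mem_ker]
          apply Subtype.ext
          have h3 : c x.1.1 = (e x.1.1.1 : X) + s x.1.1.2 := rfl
          rw [h1, h2, map_zero, add_zero] at h3
          exact h3.symm
    refine hasProjectiveDimensionLT_congr (LinearEquiv.ofBijective a ⟨?_, ?_⟩) hke
    · intro x y hxy
      have h2 : ∀ z : LinearMap.ker p', z.1.1.2 = 0 := fun z => congrArg Subtype.val z.2
      exact Subtype.ext (Subtype.ext (Prod.ext (congrArg Subtype.val hxy)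
        ((h2 x).trans (h2 y).symm)))
    · intro g
      have hg : e g.1 = 0 := g.2
      exact ⟨⟨⟨(g.1, 0), by simp [c, hg]⟩, rfl⟩, rfl⟩
  · exact fun j h1 h2 => subsingleton_ext_ker hc _ h1 (hX (j + 1) (by omega) (by omega))
  · have ht : cover N ∘ₗ (coverLift f ∘ₗ LinearMap.snd R G _) = (f ∘ₗ p) ∘ₗ c := by
      refine LinearMap.ext fun x => ?_
      have := LinearMap.congr_fun (cover_comp_coverLift f) x.2
      simp only [LinearMap.comp_apply] at this ⊢
      rw [hpc, ← this]; rfl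
    have ht' : ∀ x, ((kerMap f (coverLift f) (cover_comp_coverLift f) ∘ₗ p') x :
        Fin (coverRank N) → R) = (coverLift f ∘ₗ LinearMap.snd R G _) x := fun x => rfl
    exact ⟨mem_projectiveMaps_of_restrict hc (hX 1 le_rfl (by omega)) ht ht',
      restrict_mem_projectiveMaps (cover_surjective N) ht ht'⟩

/-- Each shift costs one unit of both homological bounds, so `m + i` at the start leaves `m` after
`i` shifts. The representative `f'` of `Ωⁱ f` is carried along because the iterated map lives on
stable classes. -/
theorem exists_syzygyPow_approximation {M N : FGModuleCat.{u} R} (f : M →ₗ[R] N)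
    {X : Type u} [AddCommGroup X] [Module R X] (p : X →ₗ[R] M) (hp : Function.Surjective p)
    (i : ℕ) : ∀ m : ℕ,
    HasProjectiveDimensionLT (ModuleCat.of R (LinearMap.ker p)) (m + i) →
    (∀ j, 1 ≤ j → j ≤ m + i →
      Subsingleton (Abelian.Ext (ModuleCat.of R X) (ModuleCat.of R R) j)) →
    ∃ (X' : Type u) (_ : AddCommGroup X') (_ : Module R X') (p' : X' →ₗ[R] syzygyPow i M)
      (f' : syzygyPow i M →ₗ[R] syzygyPow i N),
      Function.Surjective p' ∧
      HasProjectiveDimensionLT (ModuleCat.of R (LinearMap.ker p')) m ∧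
      (∀ j, 1 ≤ j → j ≤ m →
        Subsingleton (Abelian.Ext (ModuleCat.of R X') (ModuleCat.of R R) j)) ∧
      stableSyzygyPowMap M N i (Submodule.Quotient.mk f) = Submodule.Quotient.mk f' ∧
      (f' ∘ₗ p' ∈ projectiveMaps R X' (syzygyPow i N) ↔ f ∘ₗ p ∈ projectiveMaps R X N) := by
  induction i with
  | zero => exact fun m hK hX => ⟨X, inferInstance, inferInstance, p, f, hp, hK, hX, rfl, Iff.rfl⟩
  | succ i ih =>
    intro m hK hX
    obtain ⟨X₁, _, _, p₁, f₁, hp₁, hK₁, hX₁, hf₁, hiff₁⟩ :=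
      ih (m + 1) (by rwa [add_right_comm, add_assoc]) (fun j h1 h2 => hX j h1 (by omega))
    obtain ⟨X₂, _, _, p₂, hp₂, hK₂, hX₂, hiff₂⟩ := exists_syzygy_approximation f₁ p₁ hp₁ hK₁ hX₁
    refine ⟨X₂, inferInstance, inferInstance, p₂, syzygyHom f₁, hp₂, hK₂, hX₂, ?_,
      hiff₂.trans hiff₁⟩
    exact congrArg (stableSyzygyMap (syzygyPow i M) (syzygyPow i N)) hf₁

/-- Along an approximation `p : X → M`, the homomorphisms in `V_n(M, N)` are those whose
composite with `p` factors through a projective module. -/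
theorem mem_V_iff {M N : FGModuleCat.{u} R} (f : M →ₗ[R] N) {n : ℕ}
    {X : Type u} [AddCommGroup X] [Module R X] (p : X →ₗ[R] M) (hp : Function.Surjective p)
    (hK : HasProjectiveDimensionLT (ModuleCat.of R (LinearMap.ker p)) n)
    (hX : ∀ j, 1 ≤ j → j ≤ n →
      Subsingleton (Abelian.Ext (ModuleCat.of R X) (ModuleCat.of R R) j)) :
    f ∈ V n M N ↔ f ∘ₗ p ∈ projectiveMaps R X N := by
  obtain ⟨X', _, _, p', f', hp', hK', -, hf', hiff⟩ := exists_syzygyPow_approximation f p hp n 0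
    (by rwa [zero_add]) (by rwa [zero_add])
  rw [← hiff, V, LinearMap.mem_ker, LinearMap.comp_apply, Submodule.mkQ_apply, hf',
    Submodule.Quotient.mk_eq_zero]
  refine ⟨comp_mem_projectiveMaps p', fun h => ?_⟩
  -- With no bound left, `ker p'` is zero, so `p'` can be inverted and cancelled.
  have hz : Subsingleton (LinearMap.ker p') :=
    ModuleCat.subsingleton_of_isZero
      (isZero_of_hasProjectiveDimensionLT_zero (ModuleCat.of R (LinearMap.ker p')))
  let E := LinearEquiv.ofBijective p'
    ⟨LinearMap.ker_eq_bot.1 (Submodule.subsingleton_iff_eq_bot.1 hz), hp'⟩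
  have := comp_mem_projectiveMaps E.symm.toLinearMap h
  convert this
  ext x
  simp only [LinearMap.comp_apply, LinearEquiv.coe_coe]
  exact congrArg (fun y => f' y) (E.apply_symm_apply x).symm

end Shift


/-! ### Free summands from split surjections -/

section Summands

variable {R : Type u} [CommRing R]

theorem isCompl_range_ker_of_comp_eq_id {A B : Type u} [AddCommGroup A] [Module R A]
    [AddCommGroup B] [Module R B] {s : A →ₗ[R] B} {r : B →ₗ[R] A}
    (h : r ∘ₗ s = LinearMap.id) : IsCompl (LinearMap.range s) (LinearMap.ker r) := by
  have h' : ∀ x, r (s x) = x := LinearMap.congr_fun h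
  constructor
  · rw [Submodule.disjoint_def]
    rintro _ ⟨x, rfl⟩ hx
    rw [LinearMap.mem_ker, h'] at hx
    rw [hx, map_zero]
  · rw [codisjoint_iff, eq_top_iff]
    intro x _
    exact Submodule.mem_sup.2 ⟨s (r x), ⟨_, rfl⟩, x - s (r x), by simp [h'], by abel⟩

theorem hasFreeSummandOfRank_of_surjective {X : Type u} [AddCommGroup X] [Module R X] {r : ℕ}
    (a : X →ₗ[R] (Fin r → R)) (ha : Function.Surjective a) : HasFreeSummandOfRank R X r := by
  obtain ⟨s, hs⟩ := Module.projective_lifting_property a LinearMap.id ha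
  have hinj : Function.Injective s :=
    Function.LeftInverse.injective (g := a) (LinearMap.congr_fun hs)
  exact ⟨LinearMap.range s, LinearMap.ker a, isCompl_range_ker_of_comp_eq_id hs,
    ⟨(LinearEquiv.ofInjective s hinj).symm⟩⟩

end Summands

/-! ### Dimension and independent families -/

section VectorSpace

variable {K H : Type*} [Field K] [AddCommGroup H] [Module K H] [Module.Finite K H]
  (V : Submodule K H)

theorem exists_linearIndependent_fin_finrank :
    ∃ b : Fin (Module.finrank K V) → H, (∀ j, b j ∈ V) ∧ LinearIndependent K b :=
  ⟨fun j => (Module.finBasis K V j : H), fun j => (Module.finBasis K V j).2,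
    (Module.finBasis K V).linearIndependent.map' V.subtype (Submodule.ker_subtype _)⟩

theorem le_finrank_of_linearIndependent {V : Submodule K H} {r : ℕ} {b : Fin r → H}
    (hV : ∀ j, b j ∈ V) (hb : LinearIndependent K b) : r ≤ Module.finrank K V := by
  have h : LinearIndependent K (fun j => (⟨b j, hV j⟩ : V)) := .of_comp V.subtype hb
  simpa using h.fintype_card_le_finrank

end VectorSpace

/-! ### Functionals into the residue field and Nakayama -/

section Residue

open IsLocalRing

variable {R : Type u} [CommRing R] [IsLocalRing R]

theorem residue_smul_eq {M : Type u} [AddCommGroup M] [Module R M]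
    (f : M →ₗ[R] ResidueField R) (c : R) (x : M) : residue R c * f x = f (c • x) := by
  rw [map_smul, Algebra.smul_def]; rfl

/-- Linearly independent functionals into the residue field are jointly surjective. -/
theorem pi_surjective_of_linearIndependent {M : Type u} [AddCommGroup M] [Module R M] {r : ℕ}
    {φ : Fin r → (M →ₗ[R] ResidueField R)} (hφ : LinearIndependent (ResidueField R) φ) :
    Function.Surjective (LinearMap.pi φ) := by
  let W : Submodule (ResidueField R) (Fin r → ResidueField R) :=
    { carrier := Set.range (LinearMap.pi φ)
      zero_mem' := ⟨0, map_zero _⟩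
      add_mem' := by
        rintro _ _ ⟨x, rfl⟩ ⟨y, rfl⟩
        exact ⟨x + y, map_add _ _ _⟩
      smul_mem' := by
        rintro c _ ⟨x, rfl⟩
        obtain ⟨c, rfl⟩ := residue_surjective c
        exact ⟨c • x, funext fun i => (residue_smul_eq (φ i) c x).symm⟩ }
  have hW : W = ⊤ := by
    by_contra hne
    -- A nonzero form vanishing on the image would be a linear relation among the `φ i`.
    obtain ⟨l, hl, hWl⟩ := W.exists_le_ker_of_lt_top (lt_top_iff_ne_top.2 hne)
    refine hl (LinearMap.pi_ext' fun i => LinearMap.ext_ring ?_)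
    have hsum : ∑ i, l (Pi.single i 1) • φ i = 0 := by
      ext x
      have h1 : l (LinearMap.pi φ x) = 0 := hWl ⟨x, rfl⟩
      rw [pi_eq_sum_univ' (LinearMap.pi φ x), map_sum] at h1
      simpa [LinearMap.sum_apply, mul_comm] using h1
    exact Fintype.linearIndependent_iff.1 hφ _ hsum i
  intro v
  exact (hW.symm ▸ Submodule.mem_top : v ∈ W)

/-- A homomorphism into a finite free module that is surjective modulo the maximal ideal is
surjective. -/
theorem surjective_of_residue_surjective {X : Type u} [AddCommGroup X] [Module R X] {r : ℕ}
    (a : X →ₗ[R] (Fin r → R))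
    (ha : ∀ v : Fin r → ResidueField R, ∃ x, ∀ i, residue R (a x i) = v i) :
    Function.Surjective a := by
  rw [← LinearMap.range_eq_top, eq_top_iff]
  refine Submodule.le_of_le_smul_of_le_jacobson_bot (I := maximalIdeal R) Module.Finite.fg_top
    (maximalIdeal_le_jacobson _) fun v _ => ?_
  obtain ⟨x, hx⟩ := ha fun i => residue R (v i)
  refine Submodule.mem_sup.2 ⟨a x, ⟨x, rfl⟩, v - a x, ?_, by abel⟩
  rw [pi_eq_sum_univ' (v - a x)]
  refine Submodule.sum_mem _ fun i _ => Submodule.smul_mem_smul ?_ Submodule.mem_top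
  rw [← residue_eq_zero_iff, Pi.sub_apply, map_sub, hx, sub_self]

instance finite_hom_residueField (M : Type u) [AddCommGroup M] [Module R M] [Module.Finite R M] :
    Module.Finite (ResidueField R) (M →ₗ[R] ResidueField R) := by
  obtain ⟨m, c, hc⟩ := Module.Finite.exists_fin' R M
  let ev : (M →ₗ[R] ResidueField R) →ₗ[ResidueField R] (Fin m → ResidueField R) :=
    { toFun f i := f (c (Pi.single i 1))
      map_add' _ _ := rfl
      map_smul' _ _ := rfl }
  refine Module.Finite.of_injective ev fun f g h => ?_
  have : f ∘ₗ c = g ∘ₗ c := LinearMap.pi_ext' fun i => LinearMap.ext_ring (congrFun h i)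
  exact LinearMap.ext fun x => by
    obtain ⟨x, rfl⟩ := hc x
    exact LinearMap.congr_fun this x

end Residue

/-! ### Minimal approximations and the two inequalities -/

section Minimal

open IsLocalRing

variable {R : Type u} [CommRing R]

theorem IsABApproximation.hasProjectiveDimensionLT_ker {n : ℕ} {Y X M : Type u} [AddCommGroup Y]
    [Module R Y] [AddCommGroup X] [Module R X] [AddCommGroup M] [Module R M]
    {i : Y →ₗ[R] X} {p : X →ₗ[R] M} (h : IsABApproximation n i p) :
    HasProjectiveDimensionLT (ModuleCat.of R (LinearMap.ker p)) n :=
  hasProjectiveDimensionLT_congr ((LinearEquiv.ofEq _ _ h.exact.linearMap_ker_eq).trans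
    (LinearEquiv.ofInjective i h.injective).symm) h.projDim_lt

/-- Splitting off a direct summand of `X` contained in the image of `Y` yields another
approximation. -/
theorem IsABApproximation.restrict {n : ℕ} {Y X M : Type u} [AddCommGroup Y]
    [Module R Y] [AddCommGroup X] [Module R X] [AddCommGroup M] [Module R M]
    {i : Y →ₗ[R] X} {p : X →ₗ[R] M} (h : IsABApproximation n i p)
    {X₀ X₁ : Submodule R X} (hc : IsCompl X₁ X₀) (h₀ : X₀ ≤ LinearMap.range i) :
    IsABApproximation n (i.restrict (p := X₁.comap i) (q := X₁) fun _ hx => hx)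
      (p ∘ₗ X₁.subtype) := by
  have := h.finite_left
  have := h.finite_middle
  have hker := h.exact.linearMap_ker_eq
  let q : X →ₗ[R] X₁ := Submodule.projectionOnto X₁ X₀ hc
  have hq : q ∘ₗ X₁.subtype = LinearMap.id := Submodule.projectionOnto_comp_subtype hc
  have hq₀ : ∀ x, x - q x ∈ X₀ := fun x => Submodule.sub_projection_mem hc x
  have hi : ∀ y, (q (i y) : X) ∈ LinearMap.range i := fun y => by
    have := Submodule.sub_mem _ (LinearMap.mem_range_self i y) (h₀ (hq₀ (i y)))
    rwa [sub_sub_cancel] at this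
  let E := LinearEquiv.ofInjective i h.injective
  have hE : ∀ z, i (E.symm z) = z := fun z => congrArg Subtype.val (E.apply_symm_apply z)
  -- Since `X₀ ⊆ Im i`, projecting to `X₁` preserves `Im i`; transported to `Y`, it makes the new
  -- left-hand term a retract of `Y`.
  let ρ : Y →ₗ[R] X₁.comap i :=
    (E.symm.toLinearMap ∘ₗ (X₁.subtype ∘ₗ q ∘ₗ i).codRestrict (LinearMap.range i) hi).codRestrict _
      fun y => by
        rw [Submodule.mem_comap, LinearMap.comp_apply, LinearEquiv.coe_coe, hE]
        exact (q (i y)).2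
  have hρi : ∀ y, i (ρ y) = q (i y) := fun y => hE _
  have hρ : ρ ∘ₗ (X₁.comap i).subtype = LinearMap.id := LinearMap.ext fun y =>
    Subtype.ext <| h.injective <| (hρi y).trans <|
      congrArg Subtype.val (LinearMap.congr_fun hq ⟨i y, y.2⟩)
  refine ⟨?_, ?_, ?_, ?_, ?_, ?_, ?_⟩
  · exact Module.Finite.of_surjective ρ
      (Function.RightInverse.surjective (g := (X₁.comap i).subtype) (LinearMap.congr_fun hρ))
  · exact Module.Finite.of_surjective q (Submodule.projectionOnto_surjective hc)
  · exact fun y z hyz => Subtype.ext (h.injective (congrArg Subtype.val hyz))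
  · intro x
    constructor
    · intro hx
      obtain ⟨y, hy⟩ := (h.exact x).1 hx
      exact ⟨⟨y, by rw [Submodule.mem_comap, hy]; exact x.2⟩, Subtype.ext hy⟩
    · rintro ⟨y, rfl⟩
      exact (h.exact _).2 ⟨y, rfl⟩
  · intro m
    obtain ⟨x, rfl⟩ := h.surjective m
    refine ⟨q x, ?_⟩
    have : x - q x ∈ LinearMap.ker p := hker ▸ h₀ (hq₀ x)
    rw [LinearMap.mem_ker, map_sub, sub_eq_zero] at this
    exact this.symm
  · exact hasProjectiveDimensionLT_of_retract _ ρ hρ h.projDim_lt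
  · exact fun j h1 h2 => subsingleton_ext_of_retract _ q hq _ (h.ext_eq_zero j h1 h2)

/-- Noetherianity gives a maximal summand `X₀` of `X` inside `Im i`. A further such summand of the
complement could be added to `X₀`, so splitting off `X₀` leaves a minimal approximation. -/
theorem IsABApproximation.exists_minimal [IsNoetherianRing R] {n : ℕ} {Y X M : Type u}
    [AddCommGroup Y] [Module R Y] [AddCommGroup X] [Module R X] [AddCommGroup M] [Module R M]
    {i : Y →ₗ[R] X} {p : X →ₗ[R] M} (h : IsABApproximation n i p) :
    ∃ (Y' X' : Type u) (_ : AddCommGroup Y') (_ : Module R Y') (_ : AddCommGroup X')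
      (_ : Module R X') (i' : Y' →ₗ[R] X') (p' : X' →ₗ[R] M),
      IsMinimalABApproximation n i' p' := by
  have := h.finite_middle
  obtain ⟨X₀, ⟨h₀, X₁, hc⟩, hmax⟩ :=
    (wellFounded_gt (α := Submodule R X)).has_min
      {X₀ | X₀ ≤ LinearMap.range i ∧ ∃ X₁, IsCompl X₁ X₀} ⟨⊥, bot_le, ⊤, isCompl_top_bot⟩
  refine ⟨_, _, _, _, _, _, _, _, h.restrict hc h₀, fun A B hAB hA => ?_⟩
  have hinj := X₁.subtype_injective
  have hsup : A.map X₁.subtype ⊔ B.map X₁.subtype = X₁ := by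
    rw [← Submodule.map_sup, hAB.sup_eq_top, Submodule.map_top, Submodule.range_subtype]
  have hdis : Disjoint (A.map X₁.subtype) (B.map X₁.subtype) := by
    rw [disjoint_iff, ← Submodule.map_inf _ hinj, hAB.inf_eq_bot, Submodule.map_bot]
  have hAi : A.map X₁.subtype ≤ LinearMap.range i := by
    rintro _ ⟨a, ha, rfl⟩
    obtain ⟨y, rfl⟩ := hA ha
    exact ⟨y, rfl⟩
  have hmem : X₀ ⊔ A.map X₁.subtype ∈
      {X₀ | X₀ ≤ LinearMap.range i ∧ ∃ X₁, IsCompl X₁ X₀} := by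
    refine ⟨sup_le h₀ hAi, B.map X₁.subtype, IsCompl.symm ⟨?_, ?_⟩⟩
    · exact hdis.disjoint_sup_left_of_disjoint_sup_right (hsup.symm ▸ hc.disjoint.symm)
    · rw [codisjoint_iff, sup_assoc, hsup, hc.symm.sup_eq_top]
  have hle : A.map X₁.subtype ≤ X₀ := by
    by_contra hne
    exact hmax _ hmem (left_lt_sup.2 hne)
  have hbot : A.map X₁.subtype = ⊥ :=
    le_bot_iff.1 (hc.disjoint (Submodule.map_subtype_le _ _) hle)
  exact Submodule.map_injective_of_injective hinj (hbot.trans (Submodule.map_bot _).symm)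

variable [IsLocalRing R]

/-- For a minimal approximation, every linear form on `X` maps the image of `Y` into the maximal
ideal. -/
theorem IsMinimalABApproximation.residue_apply_eq_zero {n : ℕ} {Y X M : Type u} [AddCommGroup Y]
    [Module R Y] [AddCommGroup X] [Module R X] [AddCommGroup M] [Module R M]
    {i : Y →ₗ[R] X} {p : X →ₗ[R] M} (h : IsMinimalABApproximation n i p) (a : X →ₗ[R] R) (y : Y) :
    residue R (a (i y)) = 0 := by
  rw [residue_eq_zero_iff, mem_maximalIdeal, mem_nonunits_iff]
  intro hu
  obtain ⟨w, hw⟩ := hu.exists_left_inv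
  -- Rescaled by `w`, the element has value 1 under `a`, so it spans a rank-one free summand inside
  -- `Im i`, against minimality.
  have hs : a ∘ₗ LinearMap.toSpanSingleton R X (w • i y) = LinearMap.id :=
    LinearMap.ext_ring (by simp [hw])
  have hbot := h.minimal _ _ (isCompl_range_ker_of_comp_eq_id hs) (by
    rintro _ ⟨c, rfl⟩
    exact ⟨c • w • y, by simp⟩)
  have h0 : LinearMap.toSpanSingleton R X (w • i y) = 0 := LinearMap.range_eq_bot.1 hbot
  rw [h0, LinearMap.comp_zero] at hs
  exact zero_ne_one (LinearMap.congr_fun hs 1)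

variable [IsNoetherianRing R]

theorem IsABApproximation.mem_residueV_iff {n : ℕ} {Y X M : Type u} [AddCommGroup Y]
    [Module R Y] [AddCommGroup X] [Module R X] [AddCommGroup M] [Module R M] [Module.Finite R M]
    {i : Y →ₗ[R] X} {p : X →ₗ[R] M} (h : IsABApproximation n i p)
    (f : M →ₗ[R] ResidueField R) :
    f ∈ residueV R n M ↔ f ∘ₗ p ∈ projectiveMaps R X (ResidueField R) :=
  mem_V_iff (M := FGModuleCat.of R M) (N := FGModuleCat.of R (ResidueField R)) f p h.surjective
    h.hasProjectiveDimensionLT_ker h.ext_eq_zero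

/-- Minimality plays no role here: a basis of `V_n(M)`, pulled back to `X` and lifted to forms into
`R`, is jointly surjective by Nakayama. -/
theorem IsABApproximation.hasFreeSummandOfRank_xi {n : ℕ} {Y X M : Type u} [AddCommGroup Y]
    [Module R Y] [AddCommGroup X] [Module R X] [AddCommGroup M] [Module R M] [Module.Finite R M]
    {i : Y →ₗ[R] X} {p : X →ₗ[R] M} (h : IsABApproximation n i p) :
    HasFreeSummandOfRank R X (xi R n M) := by
  obtain ⟨b, hb, hli⟩ := exists_linearIndependent_fin_finrank (residueV R n M)
  choose a ha using fun j => exists_lift_of_mem_projectiveMaps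
    ((h.mem_residueV_iff _).1 (hb j)) (d := Algebra.linearMap R (ResidueField R))
    residue_surjective
  refine hasFreeSummandOfRank_of_surjective (LinearMap.pi a)
    (surjective_of_residue_surjective _ fun v => ?_)
  obtain ⟨m, rfl⟩ := pi_surjective_of_linearIndependent hli v
  obtain ⟨x, rfl⟩ := h.surjective m
  exact ⟨x, fun j => LinearMap.congr_fun (ha j) x⟩

theorem IsMinimalABApproximation.le_xi {n : ℕ} {Y X M : Type u} [AddCommGroup Y]
    [Module R Y] [AddCommGroup X] [Module R X] [AddCommGroup M] [Module R M] [Module.Finite R M]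
    {i : Y →ₗ[R] X} {p : X →ₗ[R] M} (h : IsMinimalABApproximation n i p) {r : ℕ}
    (hr : HasFreeSummandOfRank R X r) : r ≤ xi R n M := by
  obtain ⟨F, N, hFN, ⟨e⟩⟩ := hr
  let a (j : Fin r) : X →ₗ[R] R :=
    LinearMap.proj j ∘ₗ e.toLinearMap ∘ₗ Submodule.projectionOnto F N hFN
  have ha : ∀ j l, a j (e.symm (Pi.single l 1)) = (Pi.single l 1 : Fin r → R) j := fun j l => by
    simp [a]
  let E := p.quotKerEquivOfSurjective h.surjective
  let π := Algebra.linearMap R (ResidueField R)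
  -- The only use of minimality: the reduced coordinate forms vanish on `Im i` and so descend to
  -- `M`.
  have hker : ∀ j, LinearMap.ker p ≤ LinearMap.ker (π ∘ₗ a j) := fun j x hx => by
    rw [h.exact.linearMap_ker_eq] at hx
    obtain ⟨y, rfl⟩ := hx
    exact h.residue_apply_eq_zero (a j) y
  let φ (j : Fin r) : M →ₗ[R] ResidueField R :=
    (LinearMap.ker p).liftQ (π ∘ₗ a j) (hker j) ∘ₗ E.symm.toLinearMap
  have hφ : ∀ j x, φ j (p x) = residue R (a j x) := fun j x => by
    have h1 : E.symm (p x) = (LinearMap.ker p).mkQ x := by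
      rw [LinearEquiv.symm_apply_eq]; rfl
    simp only [φ, LinearMap.comp_apply, LinearEquiv.coe_coe, h1, Submodule.mkQ_apply,
      Submodule.liftQ_apply]
    rfl
  have hmem : ∀ j, φ j ∈ residueV R n M := fun j =>
    (h.mem_residueV_iff _).2 ⟨R, inferInstance, inferInstance, inferInstance, a j, π,
      LinearMap.ext (hφ j)⟩
  refine le_finrank_of_linearIndependent hmem ?_
  rw [Fintype.linearIndependent_iff]
  intro g hg l
  -- Evaluation at the image of the `l`-th basis vector of `F` isolates the coefficient `g l`.
  have h1 := LinearMap.congr_fun hg (p (e.symm (Pi.single l 1)))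
  simpa [LinearMap.sum_apply, hφ, ha, Pi.single_apply] using h1

end Minimal

end ApproxXi

theorem theorem4p12 {R : Type u} [CommRing R] [IsLocalRing R] [IsNoetherianRing R]
    (n : ℕ) (M : Type u) [AddCommGroup M] [Module R M] [Module.Finite R M]
    (hM : ApproxXi.MemA R n M) :
    (∃ (Y X : Type u) (_ : AddCommGroup Y) (_ : Module R Y) (_ : AddCommGroup X) (_ : Module R X)
      (i : Y →ₗ[R] X) (p : X →ₗ[R] M), ApproxXi.IsMinimalABApproximation n i p) ∧
    ∀ (Y X : Type u) [AddCommGroup Y] [Module R Y] [AddCommGroup X] [Module R X]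
      (i : Y →ₗ[R] X) (p : X →ₗ[R] M), ApproxXi.IsMinimalABApproximation n i p →
      IsGreatest {r : ℕ | ApproxXi.HasFreeSummandOfRank R X r} (ApproxXi.xi R n M) := by
  obtain ⟨-, Y, X, _, _, _, _, i, p, h⟩ := hM
  exact ⟨h.exists_minimal, fun Y X _ _ _ _ i p h =>
    ⟨h.toIsABApproximation.hasFreeSummandOfRank_xi, fun r hr => h.le_xi hr⟩⟩
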